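/- Let $P$ be a (non-singular) projective structure on the punctured unit disc $\mathbb{D}^{\ast}=\{z\in\mathbb{C}: 0<|z|<1\}$, i.e. an atlas of holomorphic charts whose changes of coordinates are locally restrictions of Möbius transformations of $\mathbb{CP}^1$. Let $p:E\to\mathbb{D}^{\ast}$ be the universal covering, let $D:E\to\mathbb{CP}^1$ be a developing map of $P$ and $\mu:\pi_1(\mathbb{D}^{\ast})\to \mathrm{PSL}(2,\mathbb{C})$ its monodromy representation, so that $D([c]\cdot x)=\mu(c)\cdot D(x)$ for all $x\in E$ and $c\in\pi_1(\mathbb{D}^{\ast})$, where $[c]$ is the covering automorphism induced by $c$. Assume that $P$ is uniformizable, i.e. that the map $D_\mu:E/\ker\mu\to\mathbb{CP}^1$ induced by $D$ on the monodromy covering $E/\ker\mu$ is injective. If $\gamma\in\mathrm{PSL}(2,\mathbb{C})$ generates the monodromy group $\mu(\pi_1(\mathbb{D}^{\ast}))$, then $\gamma$ is not hyperbolic (loxodromic): it is either elliptic (the identity being counted as elliptic, of order $1$) or parabolic. Here, for a lift $A\in \mathrm{SL}(2,\mathbb{C})$ of $\gamma\neq 1$, $\gamma$ is elliptic if $\operatorname{tr}A\in(-2,2)$,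 parabolic if $\operatorname{tr}A=\pm2$, and hyperbolic if $\operatorname{tr}A\notin[-2,2]$. -/

import Mathlib

open scoped MatrixGroups Manifold ContDiff Topology

noncomputable section

/-! ### Möbius transformations of the Riemann sphere `OnePoint ℂ` -/

/-- The homomorphism from `SL(2, ℂ)` to the permutations of the Riemann sphere that sends a matrix
to the Möbius transformation `z ↦ (a z + b) / (c z + d)`. -/
def slMoebiusHom : SL(2, ℂ) →* Equiv.Perm (OnePoint ℂ) :=
  (MulAction.toPermHom (GL (Fin 2) ℂ) (OnePoint ℂ)).comp
    Matrix.SpecialLinearGroup.toGL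

theorem slMoebiusHom_apply (A : SL(2, ℂ)) (x : OnePoint ℂ) :
    slMoebiusHom A x = (Matrix.SpecialLinearGroup.toGL A : GL (Fin 2) ℂ) • x := rfl

theorem slMoebiusHom_center (A : SL(2, ℂ)) (hA : A ∈ Subgroup.center SL(2, ℂ)) :
    slMoebiusHom A = 1 := by
  obtain ⟨r, hr, hA'⟩ := Matrix.SpecialLinearGroup.mem_center_iff.mp hA
  have hr0 : r ≠ 0 := by
    rintro rfl
    simp at hr
  have h00 : A.1 0 0 = r := by rw [← hA']; simp
  have h01 : A.1 0 1 = 0 := by rw [← hA']; simp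
  have h10 : A.1 1 0 = 0 := by rw [← hA']; simp
  have h11 : A.1 1 1 = r := by rw [← hA']; simp
  ext x
  rw [slMoebiusHom_apply, Equiv.Perm.one_apply]
  cases x with
  | infty => simp [OnePoint.smul_infty_eq_ite, h10]
  | coe z => simp [OnePoint.smul_some_eq_ite, h00, h01, h10, h11, hr0]

/-- `PSL(2, ℂ)` acts on the Riemann sphere by Möbius transformations. -/
instance pslMoebiusAction : MulAction PSL(2, ℂ) (OnePoint ℂ) :=
  MulAction.compHom (OnePoint ℂ)
    (QuotientGroup.lift (Subgroup.center SL(2, ℂ)) slMoebiusHom slMoebiusHom_center)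

theorem psl_mk_smul (A : SL(2, ℂ)) (x : OnePoint ℂ) :
    (QuotientGroup.mk A : PSL(2, ℂ)) • x =
      (Matrix.SpecialLinearGroup.toGL A : GL (Fin 2) ℂ) • x := rfl

/-- An element of `PSL(2, ℂ)` is elliptic if the trace of a lift to `SL(2, ℂ)` is a real number in
the open interval `(-2, 2)`. In particular it is not the identity. -/
def IsEllipticMoebius (g : PSL(2, ℂ)) : Prop :=
  ∃ A : SL(2, ℂ), (QuotientGroup.mk A : PSL(2, ℂ)) = g ∧
    ∃ t : ℝ, |t| < 2 ∧ A.1.trace = (t : ℂ)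

/-- An element of `PSL(2, ℂ)` is parabolic if it is not the identity and the trace of a lift to
`SL(2, ℂ)` is `2` or `-2`. -/
def IsParabolicMoebius (g : PSL(2, ℂ)) : Prop :=
  g ≠ 1 ∧ ∃ A : SL(2, ℂ), (QuotientGroup.mk A : PSL(2, ℂ)) = g ∧
    (A.1.trace = 2 ∨ A.1.trace = -2)

/-- An element of `PSL(2, ℂ)` is hyperbolic (in the wide sense, that is, loxodromic) if the trace of
a lift to `SL(2, ℂ)` does not lie in the real interval `[-2, 2]`. -/
def IsHyperbolicMoebius (g : PSL(2, ℂ)) : Prop :=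
  ∃ A : SL(2, ℂ), (QuotientGroup.mk A : PSL(2, ℂ)) = g ∧
    ∀ t : ℝ, |t| ≤ 2 → A.1.trace ≠ (t : ℂ)

/-! ### Projective structures -/

/-- A projective structure on a Riemann surface `X`: an atlas of holomorphic charts all of whose
changes of coordinates are (locally) restrictions of Möbius transformations. -/
structure ProjectiveStructure (X : Type*) [TopologicalSpace X] [ChartedSpace ℂ X] where
  /-- the projective charts -/
  charts : Set (OpenPartialHomeomorph X ℂ)
  holomorphic : charts ⊆ IsManifold.maximalAtlas 𝓘(ℂ) ω X
  cover : ∀ x : X, ∃ φ ∈ charts, x ∈ φ.source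
  moebius : ∀ φ ∈ charts, ∀ ψ ∈ charts, ∀ x ∈ φ.source ∩ ψ.source,
    ∃ g : PSL(2, ℂ), ∀ᶠ y in 𝓝 x, ((ψ y : ℂ) : OnePoint ℂ) = g • ((φ y : ℂ) : OnePoint ℂ)

/-! ### Covering automorphisms, developing maps and monodromy -/

section Developing

variable {X E : Type*} [TopologicalSpace X] [TopologicalSpace E]

/-- The group of covering automorphisms (deck transformations) of `p : E → X`. If `p` is the
universal covering of `X`, this is the fundamental group of `X`, acting on `E`. -/
def deckGroup (p : E → X) : Subgroup (E ≃ₜ E) where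
  carrier := {h | ∀ e, p (h e) = p e}
  mul_mem' := fun {a b} ha hb e => (ha (b e)).trans (hb e)
  one_mem' := fun _ => rfl
  inv_mem' := fun {a} ha e => by
    have h := ha (a.symm e)
    rw [Homeomorph.apply_symm_apply] at h
    exact h.symm

instance deckAction (p : E → X) : MulAction (deckGroup p) E where
  smul h e := h.1 e
  one_smul _ := rfl
  mul_smul _ _ _ := rfl

variable [ChartedSpace ℂ X]

/-- A developing map of the projective structure `P`, defined on the universal covering
`p : E → X`, together with its monodromy representation. -/
structure DevelopingPair (P : ProjectiveStructure X) (p : E → X) where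
  /-- the developing map -/
  dev : E → OnePoint ℂ
  /-- the monodromy representation -/
  mon : deckGroup p →* PSL(2, ℂ)
  /-- The developing map agrees locally with the charts of `P`, up to Möbius transformations. -/
  local_chart : ∀ e : E, ∀ φ ∈ P.charts, p e ∈ φ.source →
    ∃ g : PSL(2, ℂ), ∀ᶠ e' in 𝓝 e, dev e' = g • ((φ (p e') : ℂ) : OnePoint ℂ)
  equivariant : ∀ (c : deckGroup p) (e : E), dev (c • e) = mon c • dev e

namespace DevelopingPair

variable {P : ProjectiveStructure X} {p : E → X} (d : DevelopingPair P p)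

/-- The monodromy group, that is, the image of the monodromy representation. -/
def monodromyGroup : Subgroup PSL(2, ℂ) := d.mon.range

/-- The monodromy covering of `X`: the quotient of the universal covering by the kernel of the
monodromy representation. -/
abbrev MonodromyCovering : Type _ := MulAction.orbitRel.Quotient d.mon.ker E

/-- The monodromy-developing map: the developing map, descended to the monodromy covering. -/
def monodromyDev : d.MonodromyCovering → OnePoint ℂ :=
  Quotient.lift d.dev (by
    rintro a b ⟨c, rfl⟩
    have hc : d.mon c.1 = 1 := c.2
    have h := d.equivariant c.1 b
    rw [hc, one_smul] at h
    exact h)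

/-- The projective structure is uniformizable if its developing map is injective on the monodromy
covering. -/
def IsUniformizable : Prop := Function.Injective d.monodromyDev

end DevelopingPair

end Developing

/-- The punctured unit disc, as an open subset (hence a Riemann surface) of `ℂ`. -/
def puncturedDisc : TopologicalSpace.Opens ℂ where
  carrier := {z | z ≠ 0 ∧ ‖z‖ < 1}
  is_open' := isOpen_ne.inter (isOpen_lt continuous_norm continuous_const)

end

/-! Suppose the monodromy `γ` is hyperbolic. The exponential map from the left half plane lifts to
the universal covering, so the developing map can be read on the half plane, where deck
transformations become translations by multiples of `2πi`. A hyperbolic `γ` has infinite order, so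
only the trivial translation has trivial monodromy, and uniformizability makes the developing map
injective on the whole half plane. It then avoids the two fixed points of `γ`. Moving these to `0`
and `∞` gives an injective holomorphic `h` without zeros such that `h (z + iT) = l * h z` with `‖l‖
≠ 1`.

The length-area method excludes such an `h` (`not_injOn_of_multiplicative`). Take `‖l‖ > 1`. In the
metric `|dw|/|w|`, the image of each vertical segment of length `T` crosses an annulus of
logarithmic width `log ‖l‖`. By Cauchy-Schwarz each abscissa contributes at least `(log ‖l‖)² / T`
to the area, and there are infinitely many abscissas, measured by length. By injectivity the area is
at most that of one fundamental annulus, which is finite. -/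

noncomputable section

open MeasureTheory Set Complex

/-- Cauchy-Schwarz for the increment of a `C¹` function. -/
theorem ofReal_sq_div_le_lintegral_deriv_sq {u u' : ℝ → ℝ} {T : ℝ} (hT : 0 < T)
    (hu : ∀ y, HasDerivAt u (u' y) y) (hc : Continuous u') :
    ENNReal.ofReal ((u T - u 0) ^ 2 / T) ≤ ∫⁻ y in Ioc 0 T, ENNReal.ofReal (u' y ^ 2) := by
  have hint : IntegrableOn (fun y => u' y ^ 2) (Ioc 0 T) :=
    ((hc.pow 2).integrableOn_Icc).mono_set Ioc_subset_Icc_self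
  rw [← ofReal_integral_eq_lintegral_ofReal hint (Filter.Eventually.of_forall fun y => sq_nonneg _)]
  apply ENNReal.ofReal_le_ofReal
  rw [← intervalIntegral.integral_of_le hT.le]
  set a := (u T - u 0) / T with ha
  have h1 : ∫ y in (0 : ℝ)..T, (2 * a * u' y - a ^ 2) = (u T - u 0) ^ 2 / T := by
    have hi : Continuous fun y => 2 * a * u' y := by fun_prop
    rw [intervalIntegral.integral_sub (hi.intervalIntegrable _ _)
      (continuous_const.intervalIntegrable _ _), intervalIntegral.integral_const_mul,
      intervalIntegral.integral_eq_sub_of_hasDerivAt (fun y _ => hu y) (hc.intervalIntegrable _ _)]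
    simp only [intervalIntegral.integral_const, smul_eq_mul, sub_zero, ha]
    field_simp
    ring
  rw [← h1]
  have hi : Continuous fun y => 2 * a * u' y - a ^ 2 := by fun_prop
  have hi' : Continuous fun y => u' y ^ 2 := by fun_prop
  refine intervalIntegral.integral_mono_on hT.le (hi.intervalIntegrable _ _)
    (hi'.intervalIntegrable _ _) fun y _ => ?_
  nlinarith [sq_nonneg (u' y - a)]

theorem isOpen_re_neg : IsOpen {z : ℂ | z.re < 0} := isOpen_lt continuous_re continuous_const

/-! ### Length-area estimate for equivariant injective functions -/

section LengthArea

variable {h : ℂ → ℂ} {T : ℝ} {l : ℂ}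

/-- The real Jacobian of a holomorphic map is the norm from `ℂ` to `ℝ` of its derivative, that is
`‖h'‖²`. -/
theorem lintegral_norm_deriv_sq_eq_volume_image {s : Set ℂ} (hs : MeasurableSet s)
    (hd : ∀ z ∈ s, DifferentiableAt ℂ h z) (hinj : InjOn h s) :
    ∫⁻ z in s, ENNReal.ofReal (‖deriv h z‖ ^ 2) = volume (h '' s) := by
  rw [← lintegral_abs_det_fderiv_eq_addHaar_image volume hs (f' := fun z =>
    (fderiv ℂ h z).restrictScalars ℝ)
    (fun z hz => ((hd z hz).hasFDerivAt.restrictScalars ℝ).hasFDerivWithinAt) hinj]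
  refine lintegral_congr fun z => ?_
  congr 1
  rw [ContinuousLinearMap.det, ContinuousLinearMap.coe_restrictScalars,
    LinearMap.det_restrictScalars, LinearMap.det_ring, Algebra.norm_complex_apply,
    Complex.normSq_eq_norm_sq, abs_of_nonneg (sq_nonneg _)]
  simp

theorem hasDerivAt_log_norm {g : ℝ → ℂ} {g' : ℂ} {y : ℝ} (hg : HasDerivAt g g' y) (h0 : g y ≠ 0) :
    HasDerivAt (fun y => Real.log ‖g y‖) (g' / g y).re y := by
  have h1 := (hg.norm_sq.log (by simpa using h0)).div_const 2
  have e : (fun y => Real.log ‖g y‖) = fun y => Real.log (‖g y‖ ^ 2) / 2 := by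
    ext y
    rw [Real.log_pow]
    push_cast
    ring
  rw [e]
  have e' : (g' / g y).re = 2 * inner ℝ (g y) g' / ‖g y‖ ^ 2 / 2 := by
    rw [← Complex.normSq_eq_norm_sq, Complex.div_re]
    simp only [Complex.inner, mul_re, conj_re, conj_im]
    ring
  rw [e']
  exact h1

/-- The points of a line whose images under an equivariant function lie in a fundamental annulus
form a fundamental domain for the translations. -/
theorem isAddFundamentalDomain_of_add_eq {u : ℝ → ℝ} {c : ℝ} (hc : 0 < c)
    (hu : Continuous u) (hper : ∀ y, u (y + T) = u y + c) :
    IsAddFundamentalDomain (AddSubgroup.zmultiples T) (u ⁻¹' Ico 0 c) volume := by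
  have hz : ∀ (n : ℤ) y, u (n • T + y) = u y + n • c := by
    have hnat : ∀ (n : ℕ) y, u (n • T + y) = u y + n • c := by
      intro n
      induction n with
      | zero => simp
      | succ n ih =>
        intro y
        rw [succ_nsmul, succ_nsmul, add_assoc, ih, add_comm T, hper]
        ring
    intro n y
    obtain ⟨m, rfl | rfl⟩ := n.eq_nat_or_neg
    · simpa using hnat m y
    · have := hnat m (-(m • T) + y)
      rw [add_neg_cancel_left] at this
      simp only [neg_smul, natCast_zsmul, this]
      ring
  refine IsAddFundamentalDomain.mk' (hu.measurable measurableSet_Ico).nullMeasurableSet ?_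
  intro y
  -- `u` need not be monotone: it carries the orbit of `y` bijectively onto `u y + ℤc`, which meets
  -- `[0, c)` exactly once.
  obtain ⟨n, hn, hn'⟩ := existsUnique_add_zsmul_mem_Ico hc (u y) 0
  refine ⟨⟨n • T, n, rfl⟩, ?_, ?_⟩
  · change u (n • T + y) ∈ Ico 0 c
    rw [hz]
    simpa using hn
  · rintro ⟨_, m, rfl⟩ hm
    change u (m • T + y) ∈ Ico 0 c at hm
    rw [hz] at hm
    have : m = n := hn' m (by simpa using hm)
    simp [this]

/-- The area form `‖h'/h‖²` is invariant under the translation. Its integral over a fundamental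
domain is finite by injectivity and infinite by the estimate on vertical lines. -/
theorem not_injOn_of_multiplicative_aux (hd : DifferentiableOn ℂ h {z | z.re < 0})
    (hinj : InjOn h {z | z.re < 0}) (h0 : ∀ z, z.re < 0 → h z ≠ 0) (hT : 0 < T)
    (hl : 1 < ‖l‖) (hper : ∀ z, z.re < 0 → h (z + T * I) = l * h z) : False := by
  have hl0 : l ≠ 0 := norm_pos_iff.1 (one_pos.trans hl)
  have hda : ∀ z : ℂ, z.re < 0 → DifferentiableAt ℂ h z := fun z hz =>
    hd.differentiableAt (isOpen_re_neg.mem_nhds hz)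
  have hdc : ContinuousOn (deriv h) {z | z.re < 0} := (hd.deriv isOpen_re_neg).continuousOn
  have hc : 0 < Real.log ‖l‖ := Real.log_pos hl
  set c := Real.log ‖l‖
  set q : ℂ → ENNReal := fun z => ENNReal.ofReal (‖deriv h z / h z‖ ^ 2) with hq
  -- This fundamental domain is cut out by the values of `h`, not by a horizontal strip, so that its
  -- image visibly lies in a bounded annulus.
  set U : Set ℂ := {z | z.re < 0 ∧ Real.log ‖h z‖ ∈ Ico 0 c} with hU
  have hUH : U ⊆ {z | z.re < 0} := fun z hz => hz.1
  have hlogc : ContinuousOn (fun z => Real.log ‖h z‖) {z | z.re < 0} :=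
    hd.continuousOn.norm.log fun z hz => norm_ne_zero_iff.2 (h0 z hz)
  have hUm : MeasurableSet U := by
    have h1 := hlogc.isOpen_inter_preimage isOpen_re_neg (isOpen_Iio (a := (0 : ℝ)))
    have h2 := hlogc.isOpen_inter_preimage isOpen_re_neg (isOpen_Iio (a := c))
    convert h2.measurableSet.diff h1.measurableSet using 1
    ext z
    simp only [hU, mem_ofPred_eq, mem_Ico, mem_sdiff, mem_inter_iff, mem_preimage, mem_Iio, not_and,
      not_lt]
    tauto
  have hqm : AEMeasurable q (volume.restrict U) := by
    refine AEMeasurable.mono_measure ?_ (Measure.restrict_mono hUH le_rfl)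
    have : ContinuousOn q {z | z.re < 0} :=
      ENNReal.continuous_ofReal.comp_continuousOn ((hdc.div hd.continuousOn h0).norm.pow 2)
    exact this.aemeasurable isOpen_re_neg.measurableSet
  have hfin : ∫⁻ z in U, q z < ⊤ := by
    -- On `U` one has `1 ≤ ‖h‖`, so the Euclidean area of the image dominates the logarithmic one.
    calc ∫⁻ z in U, q z ≤ ∫⁻ z in U, ENNReal.ofReal (‖deriv h z‖ ^ 2) := by
          refine setLIntegral_mono' hUm fun z hz => ENNReal.ofReal_le_ofReal ?_
          have h1 : 1 ≤ ‖h z‖ := by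
            have := hz.2.1
            rwa [Real.le_log_iff_exp_le (norm_pos_iff.2 (h0 z hz.1)), Real.exp_zero] at this
          rw [norm_div]
          gcongr
          exact div_le_self (norm_nonneg _) h1
      _ = volume (h '' U) := lintegral_norm_deriv_sq_eq_volume_image hUm
          (fun z hz => hda z hz.1) (hinj.mono hUH)
      _ ≤ volume (Metric.closedBall (0 : ℂ) ‖l‖) := by
          refine measure_mono ?_
          rintro _ ⟨z, hz, rfl⟩
          have := (Real.log_lt_log_iff (norm_pos_iff.2 (h0 z hz.1)) (one_pos.trans hl)).1 hz.2.2
          simpa using this.le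
      _ < ⊤ := measure_closedBall_lt_top
  have hslice : ∀ x : ℝ, x < 0 →
      ENNReal.ofReal (c ^ 2 / T) ≤ ∫⁻ y : ℝ, U.indicator q (x + y * I) := by
    intro x hx
    have hre : ∀ y : ℝ, ((x : ℂ) + y * I).re < 0 := fun y => by simpa using hx
    have hg : ∀ y : ℝ, HasDerivAt (fun y : ℝ => h (x + y * I)) (deriv h (x + y * I) * I) y := by
      intro y
      have h1 : HasDerivAt (fun y : ℝ => (x : ℂ) + y * I) I y := by
        simpa using ((hasDerivAt_id y).ofReal_comp.mul_const I).const_add (x : ℂ)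
      exact (hda _ (hre y)).hasDerivAt.comp y h1
    have hline : Continuous fun y : ℝ => (x : ℂ) + y * I := by fun_prop
    have hu := fun y => hasDerivAt_log_norm (hg y) (h0 _ (hre y))
    have huc : Continuous fun y : ℝ => (deriv h (x + y * I) * I / h (x + y * I)).re :=
      continuous_re.comp (((hdc.comp_continuous hline hre).mul continuous_const).div
        (hd.continuousOn.comp_continuous hline hre) fun y => h0 _ (hre y))
    have hperx : ∀ y : ℝ, (x : ℂ) + ((y + T : ℝ) : ℂ) * I = x + y * I + T * I := by
      intro y; push_cast; ring
    have huper : ∀ y : ℝ, Real.log ‖h (x + ((y + T : ℝ) : ℂ) * I)‖ =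
        Real.log ‖h (x + y * I)‖ + c := by
      intro y
      rw [hperx, hper _ (hre y), norm_mul, Real.log_mul (norm_ne_zero_iff.2 hl0)
        (norm_ne_zero_iff.2 (h0 _ (hre y))), add_comm]
    have hqper : ∀ y : ℝ, q (x + ((y + T : ℝ) : ℂ) * I) = q (x + y * I) := by
      intro y
      have hder : deriv h (x + y * I + T * I) = l * deriv h (x + y * I) := by
        rw [← deriv_comp_add_const, ← deriv_const_mul_field]
        refine Filter.EventuallyEq.deriv_eq ?_
        filter_upwards [isOpen_re_neg.mem_nhds (hre y)] with z hz using hper z hz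
      simp only [hq]
      rw [hperx, hper _ (hre y), hder, mul_div_mul_left _ _ hl0]
    have hqz : ∀ (n : AddSubgroup.zmultiples T) (y : ℝ),
        q (x + ((n +ᵥ y : ℝ) : ℂ) * I) = q (x + y * I) := by
      have hp : Function.Periodic (fun y : ℝ => q (x + y * I)) T := hqper
      rintro ⟨_, n, rfl⟩ y
      change q (x + ((n • T + y : ℝ) : ℂ) * I) = _
      rw [add_comm (n • T)]
      exact hp.zsmul n y
    have hfd := isAddFundamentalDomain_of_add_eq hc
      (continuous_iff_continuousAt.2 fun y => (hu y).continuousAt) huper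
    have hfd' := isAddFundamentalDomain_Ioc hT 0 (μ := volume)
    have hms : MeasurableSet ((fun y : ℝ => Real.log ‖h (x + y * I)‖) ⁻¹' Ico 0 c) :=
      (continuous_iff_continuousAt.2 fun y => (hu y).continuousAt).measurable measurableSet_Ico
    have hind : ∀ y : ℝ, U.indicator q (x + y * I) =
        ((fun y : ℝ => Real.log ‖h (x + y * I)‖) ⁻¹' Ico 0 c).indicator
          (fun y : ℝ => q (x + y * I)) y := by
      intro y
      simp only [indicator, hU, mem_ofPred_eq, mem_preimage, hre, true_and]
    simp_rw [hind]
    -- The slice of `U` and the interval `(0, T]` are fundamental domains for the same translations,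
    -- and `q` is periodic, so the integrals agree.
    rw [lintegral_indicator hms, hfd.setLIntegral_eq hfd' _ hqz, zero_add]
    refine le_trans ?_ ((ofReal_sq_div_le_lintegral_deriv_sq hT hu huc).trans
      (lintegral_mono fun y => ENNReal.ofReal_le_ofReal ?_))
    · have := huper 0
      rw [zero_add] at this
      rw [this, add_sub_cancel_left]
    · rw [← sq_abs]
      gcongr
      refine (abs_re_le_norm _).trans ?_
      simp
  refine hfin.not_ge ?_
  -- By Tonelli the uniform lower bound on slices is integrated over the half-line `x < 0` of
  -- infinite length.
  rw [← lintegral_indicator hUm,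
    ← Complex.volume_preserving_equiv_real_prod.symm.lintegral_comp_emb
      (MeasurableEquiv.measurableEmbedding _),
    Measure.volume_eq_prod, lintegral_prod]
  · have e : ∀ x y : ℝ, measurableEquivRealProd.symm (x, y) = x + y * I := by
      intro x y
      rw [measurableEquivRealProd_symm_apply, Complex.mk_eq_add_mul_I]
    simp_rw [e]
    calc (⊤ : ENNReal) = ∫⁻ x in Iio (0 : ℝ), ENNReal.ofReal (c ^ 2 / T) := by
          rw [setLIntegral_const, Real.volume_Iio, ENNReal.mul_top]
          have : 0 < c ^ 2 / T := by positivity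
          simpa using this
      _ ≤ ∫⁻ x in Iio (0 : ℝ), ∫⁻ y : ℝ, U.indicator q (x + y * I) :=
          setLIntegral_mono' measurableSet_Iio fun x hx => hslice x hx
      _ ≤ _ := setLIntegral_le_lintegral _ _
  · rw [← Measure.volume_eq_prod]
    exact ((aemeasurable_indicator_iff hUm).2 hqm).comp_quasiMeasurePreserving
      Complex.volume_preserving_equiv_real_prod.symm.quasiMeasurePreserving

/-- A holomorphic function without zeros on the left half plane that is multiplied by a constant of
modulus different from `1` under a vertical translation is not injective. -/
theorem not_injOn_of_multiplicative (hd : DifferentiableOn ℂ h {z | z.re < 0})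
    (h0 : ∀ z, z.re < 0 → h z ≠ 0) (hT : T ≠ 0)
    (hl : ‖l‖ ≠ 1) (hper : ∀ z, z.re < 0 → h (z + T * I) = l * h z) :
    ¬ InjOn h {z | z.re < 0} := by
  intro hinj
  have hl0 : l ≠ 0 := by
    rintro rfl
    exact h0 (-1 + T * I) (by simp) (by simp [hper])
  -- Reversing the translation replaces `l` by `l⁻¹`.
  wlog hT' : 0 < T generalizing T l
  · refine this (T := -T) (l := l⁻¹) (neg_ne_zero.2 hT) (by simpa using hl) ?_
      (inv_ne_zero hl0) (by simpa using lt_of_le_of_ne (not_lt.1 hT') hT)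
    intro z hz
    have := hper (z + (-T : ℝ) * I) (by simpa using hz)
    rw [show z + ((-T : ℝ) : ℂ) * I + T * I = z by push_cast; ring] at this
    rw [this, inv_mul_cancel_left₀ hl0]
  rcases lt_or_gt_of_ne hl with h1 | h1
  -- For `‖l‖ < 1` the reciprocal of `h` has multiplier `l⁻¹`.
  · refine not_injOn_of_multiplicative_aux (h := fun z => (h z)⁻¹) (l := l⁻¹)
      (hd.inv h0) (fun a ha b hb hab => hinj ha hb (inv_injective hab))
      (fun z hz => inv_ne_zero (h0 z hz)) hT' ?_ ?_
    · rw [norm_inv]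
      exact (one_lt_inv₀ (norm_pos_iff.2 hl0)).2 h1
    · intro z hz
      simp only [hper z hz, mul_inv]
  · exact not_injOn_of_multiplicative_aux hd hinj h0 hT' h1 hper

end LengthArea

end

noncomputable section

/-! ### Loxodromic Möbius transformations -/

/-- On the unit circle `r⁻¹` is the conjugate of `r`, so the sum is `2 * r.re`, which lies in `[-2,
2]`. -/
theorem norm_ne_one_of_add_inv_not_mem {r : ℂ}
    (h : ∀ t : ℝ, |t| ≤ 2 → r + r⁻¹ ≠ (t : ℂ)) : ‖r‖ ≠ 1 := by
  intro h1
  have hre := Complex.abs_re_le_norm r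
  refine h (2 * r.re) ?_ ?_
  · rw [abs_mul, abs_two]
    linarith
  · rw [Complex.inv_eq_conj h1, Complex.add_conj]

/-- The rows of `M` are left eigenvectors of `A` for the eigenvalues `r` and `r⁻¹`. These differ
because `‖r‖ ≠ 1`, which makes `M` invertible. -/
theorem exists_mul_eq_diagonal_mul (A : SL(2, ℂ)) (hA : ∀ t : ℝ, |t| ≤ 2 → A.1.trace ≠ (t : ℂ)) :
    ∃ (M : GL (Fin 2) ℂ) (r : ℂ), r ≠ 0 ∧ ‖r‖ ≠ 1 ∧
      M.1 * A.1 = !![r, 0; 0, r⁻¹] * M.1 := by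
  obtain ⟨s, hs⟩ := IsAlgClosed.exists_pow_nat_eq (A.1.trace ^ 2 - 4) two_pos
  have htr := Matrix.trace_fin_two A.1
  have hdet := A.2
  rw [Matrix.det_fin_two] at hdet
  have key : ∀ r : ℂ, r * (A.1.trace - r) = 1 → r ≠ 0 ∧ r + r⁻¹ = A.1.trace ∧ ‖r‖ ≠ 1 := by
    intro r hr
    have h0 : r ≠ 0 := left_ne_zero_of_mul_eq_one hr
    have h1 : r + r⁻¹ = A.1.trace := by
      rw [← eq_inv_of_mul_eq_one_right hr]
      ring
    exact ⟨h0, h1, norm_ne_one_of_add_inv_not_mem (by rwa [h1])⟩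
  set a := A.1 0 0
  set b := A.1 0 1
  set c := A.1 1 0
  set d := A.1 1 1
  have hA' : A.1 = !![a, b; c, d] := Matrix.eta_fin_two A.1
  rw [hA']
  by_cases hbc : b = 0 ∧ c = 0
  · obtain ⟨hb, hc⟩ := hbc
    have had : a * d = 1 := by rw [← hdet, hb]; ring
    obtain ⟨h0, -, hn⟩ := key a (by rw [htr, add_sub_cancel_left]; exact had)
    refine ⟨1, a, h0, hn, ?_⟩
    rw [hb, hc, eq_inv_of_mul_eq_one_right had]
    simp
  -- The quadratic formula gives a root of the characteristic polynomial, `s` being a square root of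
  -- its discriminant.
  · obtain ⟨h0, h1, hn⟩ := key ((A.1.trace + s) / 2) (by linear_combination -hs / 4)
    set r := (A.1.trace + s) / 2
    have hrr : r * r⁻¹ = 1 := mul_inv_cancel₀ h0
    have hne : r - r⁻¹ ≠ 0 := by
      intro h
      apply hn
      have : r * r = 1 := by
        rw [← hrr, ← sub_eq_zero.1 h]
      have h2 : ‖r‖ * ‖r‖ = 1 := by rw [← norm_mul, this, norm_one]
      nlinarith [norm_nonneg r]
    by_cases hc : c = 0
    · have hb : b ≠ 0 := fun hb => hbc ⟨hb, hc⟩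
      refine ⟨Matrix.GeneralLinearGroup.mkOfDetNeZero !![r - d, b; r⁻¹ - d, b] ?_, r, h0, hn, ?_⟩
      · rw [Matrix.det_fin_two_of]
        convert mul_ne_zero hb hne using 1
        ring
      · change !![r - d, b; r⁻¹ - d, b] * !![a, b; c, d] =
          !![r, 0; 0, r⁻¹] * !![r - d, b; r⁻¹ - d, b]
        rw [Matrix.mul_fin_two, Matrix.mul_fin_two]
        congr! 3 <;> grind
    · refine ⟨Matrix.GeneralLinearGroup.mkOfDetNeZero !![c, r - a; c, r⁻¹ - a] ?_, r, h0, hn, ?_⟩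
      · rw [Matrix.det_fin_two_of]
        convert mul_ne_zero hc (neg_ne_zero.2 hne) using 1
        ring
      · change !![c, r - a; c, r⁻¹ - a] * !![a, b; c, d] =
          !![r, 0; 0, r⁻¹] * !![c, r - a; c, r⁻¹ - a]
        rw [Matrix.mul_fin_two, Matrix.mul_fin_two]
        congr! 3 <;> grind

/-- A loxodromic element is conjugate to a multiplication. -/
theorem IsHyperbolicMoebius.exists_smul_eq_mul {g : PSL(2, ℂ)} (hg : IsHyperbolicMoebius g) :
    ∃ (M : GL (Fin 2) ℂ) (l : ℂ), ‖l‖ ≠ 1 ∧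
      (∀ x : OnePoint ℂ, M • x = OnePoint.infty → M • g • x = OnePoint.infty) ∧
      ∀ (x : OnePoint ℂ) (z : ℂ), M • x = (z : OnePoint ℂ) →
        M • g • x = ((l * z : ℂ) : OnePoint ℂ) := by
  obtain ⟨A, rfl, hA⟩ := hg
  obtain ⟨M, r, h0, hn, hM⟩ := exists_mul_eq_diagonal_mul A hA
  let D : GL (Fin 2) ℂ := Matrix.GeneralLinearGroup.mkOfDetNeZero !![r, 0; 0, r⁻¹]
    (by simp [Matrix.det_fin_two_of, h0])
  have hMD : M * Matrix.SpecialLinearGroup.toGL A = D * M := Units.ext hM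
  have hx : ∀ x : OnePoint ℂ, M • (QuotientGroup.mk A : PSL(2, ℂ)) • x = D • M • x := by
    intro x
    rw [psl_mk_smul, ← mul_smul, hMD, mul_smul]
  have h00 : D 0 0 = r := rfl
  have h01 : D 0 1 = 0 := rfl
  have h10 : D 1 0 = 0 := rfl
  have h11 : D 1 1 = r⁻¹ := rfl
  refine ⟨M, r ^ 2, ?_, ?_, ?_⟩
  · rw [norm_pow]
    exact fun h => hn ((pow_eq_one_iff_of_nonneg (norm_nonneg r) two_ne_zero).1 h)
  · intro x h
    rw [hx, h, OnePoint.smul_infty_eq_self_iff, h10]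
  · intro x z h
    rw [hx, h, OnePoint.smul_some_eq_ite, h00, h01, h10, h11, if_neg (by simpa using h0)]
    congr 1
    field_simp
    ring

/-- In the diagonalizing coordinate the orbit of `1` consists of the powers of `l`, and no
nontrivial power has modulus `1`. -/
theorem IsHyperbolicMoebius.eq_zero_of_zpow_eq_one {g : PSL(2, ℂ)} (hg : IsHyperbolicMoebius g) {n : ℤ}
    (h : g ^ n = 1) : n = 0 := by
  obtain ⟨M, l, hl, -, hM⟩ := hg.exists_smul_eq_mul
  have hp : ∀ m : ℕ, M • g ^ m • M⁻¹ • ((1 : ℂ) : OnePoint ℂ) = ((l ^ m : ℂ) : OnePoint ℂ) := by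
    intro m
    induction m with
    | zero => simp
    | succ m ih => rw [pow_succ', mul_smul, hM _ _ ih, pow_succ']
  have h1 := hp n.natAbs
  rw [pow_natAbs_eq_one.2 h, one_smul, smul_inv_smul, OnePoint.coe_eq_coe] at h1
  have h2 : ‖l‖ ^ n.natAbs = 1 := by rw [← norm_pow, ← h1, norm_one]
  by_contra hn
  exact hl ((pow_eq_one_iff_of_nonneg (norm_nonneg l) (Int.natAbs_ne_zero.2 hn)).1 h2)

theorem eq_one_or_elliptic_or_parabolic {g : PSL(2, ℂ)} (hg : ¬ IsHyperbolicMoebius g) :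
    (g = 1 ∨ IsEllipticMoebius g) ∨ IsParabolicMoebius g := by
  obtain ⟨A, rfl⟩ := QuotientGroup.mk_surjective g
  have : ∃ t : ℝ, |t| ≤ 2 ∧ A.1.trace = (t : ℂ) := by
    by_contra! h
    exact hg ⟨A, rfl, h⟩
  obtain ⟨t, ht, hA⟩ := this
  by_cases h1 : (QuotientGroup.mk A : PSL(2, ℂ)) = 1
  · exact Or.inl (Or.inl h1)
  rcases ht.lt_or_eq with h | h
  · exact Or.inl (Or.inr ⟨A, rfl, t, h, hA⟩)
  · refine Or.inr ⟨h1, A, rfl, ?_⟩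
    rcases (abs_eq zero_le_two).1 h with rfl | rfl
    · left; simpa using hA
    · right; simpa using hA

/-! ### The exponential parametrization of the punctured disc -/

/-- The left half plane. -/
def leftHalfPlane : TopologicalSpace.Opens ℂ where
  carrier := {z | z.re < 0}
  is_open' := isOpen_re_neg

/-- The exponential map from the left half plane onto the punctured disc. -/
def expDisc (z : leftHalfPlane) : puncturedDisc :=
  ⟨Complex.exp z, Complex.exp_ne_zero _, by
    rw [Complex.norm_exp, Real.exp_lt_one_iff]
    exact z.2⟩

theorem contMDiff_expDisc : ContMDiff 𝓘(ℂ) 𝓘(ℂ) ∞ expDisc := by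
  rw [← ContMDiff.subtypeVal_comp_iff]
  exact Complex.contDiff_exp.contMDiff.comp contMDiff_subtype_val

theorem continuous_expDisc : Continuous expDisc := contMDiff_expDisc.continuous

instance leftHalfPlane_contractible : ContractibleSpace leftHalfPlane :=
  (convex_halfSpace_re_lt 0).contractibleSpace ⟨-1, by simp⟩

instance leftHalfPlane_locallyPathConnected : LocallyPathConnectedSpace leftHalfPlane :=
  isOpen_re_neg.locallyPathConnectedSpace

/-- The translation by `2πin` of the left half plane. -/
def verticalShift (n : ℤ) (z : leftHalfPlane) : leftHalfPlane :=
  ⟨z + n * (2 * Real.pi * Complex.I), by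
    have hz : (z : ℂ).re < 0 := z.2
    change ((z : ℂ) + n * (2 * Real.pi * Complex.I)).re < 0
    simpa only [Complex.add_re, Complex.mul_re, Complex.mul_im, Complex.intCast_re,
      Complex.intCast_im, Complex.I_re, Complex.I_im, Complex.ofReal_re, Complex.ofReal_im,
      Complex.re_ofNat, Complex.im_ofNat, mul_zero, zero_mul, mul_one, sub_zero, add_zero] using hz⟩

theorem continuous_verticalShift (n : ℤ) : Continuous (verticalShift n) :=
  Continuous.subtype_mk (by fun_prop) _

theorem expDisc_verticalShift (n : ℤ) (z : leftHalfPlane) :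
    expDisc (verticalShift n z) = expDisc z :=
  Subtype.ext (Complex.exp_eq_exp_iff_exists_int.2 ⟨n, rfl⟩)

theorem expDisc_eq_iff {z w : leftHalfPlane} :
    expDisc z = expDisc w ↔ ∃ n : ℤ, z = verticalShift n w := by
  simp only [expDisc, verticalShift, Subtype.ext_iff, Complex.exp_eq_exp_iff_exists_int]

theorem verticalShift_verticalShift (m n : ℤ) (z : leftHalfPlane) :
    verticalShift m (verticalShift n z) = verticalShift (m + n) z := by
  apply Subtype.ext
  simp only [verticalShift]
  push_cast
  ring

theorem verticalShift_zero (z : leftHalfPlane) : verticalShift 0 z = z := by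
  apply Subtype.ext
  simp [verticalShift]

theorem eq_zero_of_verticalShift_eq {n : ℤ} {z : leftHalfPlane} (h : verticalShift n z = z) :
    n = 0 := by
  have := congrArg Subtype.val h
  simpa [verticalShift, Real.pi_ne_zero] using this

/-! ### Deck transformations as vertical translations -/

section Covering

variable {E : Type*} [TopologicalSpace E] {p : E → puncturedDisc}

/-- A lift through `exp` to `ℂ` stays in the half plane, since `‖exp w‖ < 1` forces `w.re < 0`. -/
theorem exists_lift_path_expDisc (γ : C(unitInterval, puncturedDisc)) (z : leftHalfPlane)
    (hz : γ 0 = expDisc z) : ∃ Γ : C(unitInterval, leftHalfPlane), Γ 0 = z ∧ expDisc ∘ Γ = γ := by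
  let γ' : C(unitInterval, {z : ℂ // z ≠ 0}) :=
    ⟨fun t => ⟨(γ t).1, (γ t).2.1⟩, by fun_prop⟩
  obtain ⟨Γ, hΓ, h0⟩ := Complex.isCoveringMap_exp.exists_path_lifts γ' (z : ℂ)
    (Subtype.ext (show (γ 0 : ℂ) = expDisc z by rw [hz]))
  have he : ∀ t, Complex.exp (Γ t) = γ t := fun t => congrArg Subtype.val (congrFun hΓ t)
  have hre : ∀ t, Γ t ∈ leftHalfPlane := by
    intro t
    change (Γ t).re < 0
    rw [← Real.exp_lt_one_iff, ← Complex.norm_exp, he]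
    exact (γ t).2.2
  exact ⟨⟨fun t => ⟨Γ t, hre t⟩, Γ.continuous.subtype_mk hre⟩, Subtype.ext h0,
    funext fun t => Subtype.ext (he t)⟩

/-- The exponential map lifts to a surjection onto any connected covering. -/
theorem exists_surjective_lift_expDisc [PathConnectedSpace E] (hp : IsCoveringMap p) :
    ∃ σ : C(leftHalfPlane, E), (∀ z, p (σ z) = expDisc z) ∧ Function.Surjective σ := by
  obtain ⟨e₀⟩ : Nonempty E := inferInstance
  have hz : (Complex.log (p e₀)).re < 0 := by
    rw [Complex.log_re]
    exact Real.log_neg (norm_pos_iff.2 (p e₀).2.1) (p e₀).2.2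
  have hz' : p e₀ = expDisc ⟨Complex.log (p e₀), hz⟩ :=
    Subtype.ext (Complex.exp_log (p e₀).2.1).symm
  obtain ⟨σ, ⟨h0, hσ⟩, -⟩ := hp.existsUnique_continuousMap_lifts ⟨expDisc, continuous_expDisc⟩
    ⟨_, hz⟩ e₀ hz'
  have hσ' : ∀ z, p (σ z) = expDisc z := congrFun hσ
  refine ⟨σ, hσ', fun e => ?_⟩
  -- A path from `e₀` to `e` and the `σ`-image of a lift of its projection agree at the start, hence
  -- everywhere.
  let P := PathConnectedSpace.somePath e₀ e
  obtain ⟨Γ, hΓ0, hΓ⟩ := exists_lift_path_expDisc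
    ⟨fun t => p (P t), hp.continuous.comp P.continuous⟩ ⟨_, hz⟩ (by simpa using hz')
  have := hp.eq_of_comp_eq (g₁ := fun t => σ (Γ t)) (g₂ := P) (by fun_prop) P.continuous
    (funext fun t => (hσ' _).trans (congrFun hΓ t)) 0 (by simp [hΓ0, h0])
  refine ⟨Γ 1, ?_⟩
  simpa using congrFun this 1

theorem deckGroup_proj (c : deckGroup p) (e : E) : p (c • e) = p e := c.2 e

theorem deckGroup_continuous_smul (c : deckGroup p) : Continuous fun e : E => c • e :=
  c.1.continuous

theorem deckGroup_ext [PreconnectedSpace E] (hp : IsCoveringMap p) {c c' : deckGroup p} {e : E}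
    (h : c • e = c' • e) : c = c' := by
  have := hp.eq_of_comp_eq (deckGroup_continuous_smul c) (deckGroup_continuous_smul c')
    (funext fun e => (deckGroup_proj c e).trans (deckGroup_proj c' e).symm) e h
  exact Subtype.ext (Homeomorph.ext fun e => congrFun this e)

variable {σ : C(leftHalfPlane, E)}

/-- Both sides are lifts of `expDisc` through `p`, so agreement at one point propagates. -/
theorem deckGroup_smul_lift_of_eq (hp : IsCoveringMap p) (hσ : ∀ z, p (σ z) = expDisc z)
    {c : deckGroup p} {n : ℤ} {z : leftHalfPlane} (h : c • σ z = σ (verticalShift n z))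
    (w : leftHalfPlane) : c • σ w = σ (verticalShift n w) := by
  have := hp.eq_of_comp_eq (g₁ := fun w => c • σ w) (g₂ := fun w => σ (verticalShift n w))
    ((deckGroup_continuous_smul c).comp σ.continuous)
    (σ.continuous.comp (continuous_verticalShift n))
    (funext fun w => by
      simp only [Function.comp_apply, deckGroup_proj, hσ, expDisc_verticalShift]) z h
  exact congrFun this w

theorem exists_deckGroup_smul_lift (hp : IsCoveringMap p) (hσ : ∀ z, p (σ z) = expDisc z)
    (hs : Function.Surjective σ) (c : deckGroup p) :
    ∃ n : ℤ, ∀ z, c • σ z = σ (verticalShift n z) := by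
  let z : leftHalfPlane := ⟨-1, by change (-1 : ℂ).re < 0; simp⟩
  obtain ⟨w, hw⟩ := hs (c • σ z)
  have : expDisc w = expDisc z := by rw [← hσ, hw, deckGroup_proj c, hσ]
  obtain ⟨n, rfl⟩ := expDisc_eq_iff.1 this
  exact ⟨n, deckGroup_smul_lift_of_eq hp hσ hw.symm⟩

theorem deckGroup_zpow_smul_lift {c : deckGroup p} {n : ℤ}
    (h : ∀ z, c • σ z = σ (verticalShift n z)) (m : ℤ) (z : leftHalfPlane) :
    c ^ m • σ z = σ (verticalShift (m * n) z) := by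
  induction m generalizing z with
  | zero => simp [verticalShift_zero]
  | succ m ih =>
    rw [zpow_add_one, mul_smul, h, ih, verticalShift_verticalShift]
    congr 2
    ring
  | pred m ih =>
    have hinv : c⁻¹ • σ z = σ (verticalShift (-n) z) := by
      rw [inv_smul_eq_iff, h, verticalShift_verticalShift, add_neg_cancel, verticalShift_zero]
    rw [zpow_sub_one, mul_smul, hinv, ih, verticalShift_verticalShift]
    congr 2
    ring

end Covering

/-! ### Developing maps in the exponential coordinate -/

/-- Since `h` takes finite values, the denominator of the Möbius transformation does not vanish. -/
theorem differentiableAt_moebius_comp_chart {U : Set ℂ} {h f : ℂ → ℂ} {z : ℂ}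
    {N : GL (Fin 2) ℂ} (hU : U ∈ 𝓝 z) (hf : DifferentiableAt ℂ f z)
    (hN : ∀ w ∈ U, ((h w : ℂ) : OnePoint ℂ) = N • ((f w : ℂ) : OnePoint ℂ)) :
    DifferentiableAt ℂ h z := by
  have key : ∀ w ∈ U, N 1 0 * f w + N 1 1 ≠ 0 ∧
      h w = (N 0 0 * f w + N 0 1) / (N 1 0 * f w + N 1 1) := by
    intro w hw
    have := hN w hw
    rw [OnePoint.smul_some_eq_ite] at this
    split_ifs at this with h0
    · exact absurd this (OnePoint.coe_ne_infty _)
    · exact ⟨h0, OnePoint.coe_injective this⟩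
  have hd : DifferentiableAt ℂ
      (fun w => (N 0 0 * f w + N 0 1) / (N 1 0 * f w + N 1 1)) z :=
    ((hf.const_mul _).add_const _).div ((hf.const_mul _).add_const _)
      (key z (mem_of_mem_nhds hU)).1
  refine hd.congr_of_eventuallyEq ?_
  filter_upwards [hU] with w hw using (key w hw).2

namespace DevelopingPair

variable {P : ProjectiveStructure puncturedDisc} {E : Type*} [TopologicalSpace E]
  {p : E → puncturedDisc} {d : DevelopingPair P p}

/-- In the exponential coordinate, a developing map followed by a Möbius transformation is
holomorphic where it takes finite values. -/
theorem differentiableOn_lift {σ : C(leftHalfPlane, E)} (hσ : ∀ z, p (σ z) = expDisc z)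
    {M : GL (Fin 2) ℂ} {h : ℂ → ℂ}
    (hh : ∀ z : leftHalfPlane, M • d.dev (σ z) = ((h z : ℂ) : OnePoint ℂ)) :
    DifferentiableOn ℂ h {z | z.re < 0} := by
  intro z hz
  apply DifferentiableAt.differentiableWithinAt
  set z' : leftHalfPlane := ⟨z, hz⟩
  obtain ⟨φ, hφ, hs⟩ := P.cover (p (σ z'))
  obtain ⟨g, hg⟩ := d.local_chart (σ z') φ hφ hs
  obtain ⟨B, rfl⟩ := QuotientGroup.mk_surjective g
  -- The value `0` outside the half plane is immaterial: differentiability is tested at a point of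
  -- this open set.
  let f : ℂ → ℂ := fun w => if hw : w.re < 0 then φ (expDisc ⟨w, hw⟩) else 0
  have hfval : ∀ w : leftHalfPlane, f w = φ (expDisc w) := fun w => dif_pos w.2
  have hf : DifferentiableAt ℂ f z := by
    have h1 : ContMDiffAt 𝓘(ℂ) 𝓘(ℂ) ∞ (fun w : leftHalfPlane => f w) z' := by
      simp_rw [hfval]
      refine ContMDiffAt.comp z' ((contMDiffAt_of_mem_maximalAtlas (P.holomorphic hφ) ?_).of_le
        le_top) contMDiff_expDisc.contMDiffAt
      rwa [← hσ]
    have h2 := (contMDiffAt_subtype_iff (f := f) (x := z')).1 h1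
    exact h2.contDiffAt.differentiableAt (by simp)
  have hev : ∀ᶠ w : leftHalfPlane in 𝓝 z', ((h w : ℂ) : OnePoint ℂ) =
      (M * Matrix.SpecialLinearGroup.toGL B) • ((f w : ℂ) : OnePoint ℂ) := by
    filter_upwards [σ.continuous.continuousAt.eventually hg] with w hw
    rw [← hh, hw, psl_mk_smul, mul_smul, hσ, hfval]
  have hU : {w : ℂ | ((h w : ℂ) : OnePoint ℂ) =
      (M * Matrix.SpecialLinearGroup.toGL B) • ((f w : ℂ) : OnePoint ℂ)} ∈ 𝓝 z := by
    have := map_nhds_subtype_coe_eq_nhds (p := fun w : ℂ => w.re < 0) hz (isOpen_re_neg.mem_nhds hz)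
    rw [← this]
    exact hev
  exact differentiableAt_moebius_comp_chart hU hf fun w hw => hw

theorem IsUniformizable.exists_mem_ker (hd : d.IsUniformizable) {e e' : E}
    (h : d.dev e = d.dev e') : ∃ c : deckGroup p, d.mon c = 1 ∧ c • e' = e := by
  have : (Quotient.mk _ e : d.MonodromyCovering) = Quotient.mk _ e' := hd h
  obtain ⟨c, hc⟩ := MulAction.orbitRel_apply.1 (Quotient.exact this)
  exact ⟨c.1, c.2, hc⟩

/-- It suffices to know that each deck transformation is some translation; neither cyclicity of the
deck group nor injectivity of `σ` has to be established first. -/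
theorem IsUniformizable.not_isHyperbolicMoebius_mon [PathConnectedSpace E] (hp : IsCoveringMap p)
    (hd : d.IsUniformizable) (c : deckGroup p) : ¬ IsHyperbolicMoebius (d.mon c) := by
  intro hyp
  obtain ⟨σ, hσ, hs⟩ := exists_surjective_lift_expDisc hp
  obtain ⟨k, hk⟩ := exists_deckGroup_smul_lift hp hσ hs c
  have hdev : ∀ z, d.dev (σ (verticalShift k z)) = d.mon c • d.dev (σ z) := by
    intro z
    rw [← hk, d.equivariant]
  have hinj : ∀ z w, d.dev (σ z) = d.dev (σ w) → z = w := by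
    intro z w hzw
    obtain ⟨g, hg, hgw⟩ := hd.exists_mem_ker hzw
    have : expDisc z = expDisc w := by rw [← hσ, ← hgw, deckGroup_proj g, hσ]
    obtain ⟨n, rfl⟩ := expDisc_eq_iff.1 this
    have hgn := deckGroup_smul_lift_of_eq hp hσ hgw
    -- Both act as the translation by `2πi * k * n`. As `g` has trivial monodromy, the `n`-th power
    -- of the hyperbolic element is trivial.
    have hpow : g ^ k = c ^ n := by
      refine deckGroup_ext hp (e := σ w) ?_
      rw [deckGroup_zpow_smul_lift hgn, deckGroup_zpow_smul_lift hk, mul_comm]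
    have hn : n = 0 := hyp.eq_zero_of_zpow_eq_one (by rw [← map_zpow, ← hpow, map_zpow, hg, one_zpow])
    rw [hn, verticalShift_zero]
  have hk0 : k ≠ 0 := by
    rintro rfl
    let z : leftHalfPlane := ⟨-1, by change (-1 : ℂ).re < 0; simp⟩
    have : c = 1 := deckGroup_ext hp (e := σ z) (by rw [hk, verticalShift_zero, one_smul])
    exact one_ne_zero (hyp.eq_zero_of_zpow_eq_one (n := 1) (by rw [this, map_one, one_zpow]))
  -- Avoiding the fixed points, which `M` sends to `0` and `∞`, is what makes `h` finite and
  -- nonzero.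
  have hfix : ∀ z, d.mon c • d.dev (σ z) ≠ d.dev (σ z) := by
    intro z h
    rw [← hdev] at h
    exact hk0 (eq_zero_of_verticalShift_eq (hinj _ _ h))
  obtain ⟨M, l, hl, hinf, hmul⟩ := hyp.exists_smul_eq_mul
  have hfin : ∀ z, ∃ w : ℂ, M • d.dev (σ z) = (w : OnePoint ℂ) := by
    intro z
    obtain ⟨w, hw⟩ := OnePoint.ne_infty_iff_exists.1 fun h =>
      hfix z (MulAction.injective M ((hinf _ h).trans h.symm))
    exact ⟨w, hw.symm⟩
  choose h' hh' using hfin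
  let h : ℂ → ℂ := fun z => if hz : z.re < 0 then h' ⟨z, hz⟩ else 0
  have hh : ∀ z : leftHalfPlane, M • d.dev (σ z) = ((h z : ℂ) : OnePoint ℂ) := by
    intro z
    rw [hh']
    congr 1
    have hz : (z : ℂ).re < 0 := z.2
    simp only [h, dif_pos hz]
  -- The sign of `k` is unknown, so the period `2πk` may be negative.
  refine not_injOn_of_multiplicative (h := h) (T := k * (2 * Real.pi)) (l := l)
    (differentiableOn_lift hσ hh) ?_ (by simp [hk0, Real.pi_ne_zero]) hl ?_ ?_
  · intro z hz h0
    have h1 := hh ⟨z, hz⟩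
    have h2 := hmul _ _ h1
    rw [h0, mul_zero] at h2
    rw [h0] at h1
    exact hfix _ (MulAction.injective M (h2.trans h1.symm))
  · intro z hz
    have h1 := hmul _ _ (hh ⟨z, hz⟩)
    rw [← hdev, hh, OnePoint.coe_eq_coe] at h1
    rw [← h1]
    congr 1
    simp only [verticalShift]
    push_cast
    ring
  · intro z hz w hw hzw
    have : M • d.dev (σ ⟨z, hz⟩) = M • d.dev (σ ⟨w, hw⟩) := by
      rw [hh, hh]
      exact congrArg _ hzw
    exact congrArg Subtype.val (hinj _ _ (MulAction.injective M this))

end DevelopingPair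

end

/-- The monodromy group of a uniformizable projective structure on the punctured disc, if it is
generated by `γ`, has `γ` not hyperbolic, but elliptic (or the identity) or parabolic. -/
theorem mainTheorem7 (P : ProjectiveStructure puncturedDisc)
    {E : Type*} [TopologicalSpace E] [SimplyConnectedSpace E]
    (p : E → puncturedDisc) (hp : IsCoveringMap p)
    (d : DevelopingPair P p) (hd : d.IsUniformizable)
    (γ : PSL(2, ℂ)) (hγ : Subgroup.zpowers γ = d.monodromyGroup) :
    ¬ IsHyperbolicMoebius γ ∧
      ((γ = 1 ∨ IsEllipticMoebius γ) ∨ IsParabolicMoebius γ) := by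
  have hmem : γ ∈ d.monodromyGroup := hγ ▸ Subgroup.mem_zpowers γ
  obtain ⟨c, rfl⟩ := hmem
  have h := hd.not_isHyperbolicMoebius_mon hp c
  exact ⟨h, eq_one_or_elliptic_or_parabolic h⟩
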